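/- **Setting.** Let $V$ be a finite set and let $\mathfrak f,\mathfrak g:2^V\to\mathbb R_{\ge 0}$ be monotone set functions with $\mathfrak f(\emptyset)=\mathfrak g(\emptyset)=0$, where $\mathfrak f$ is supermodular, $\mathfrak g$ is submodular, and $\mathfrak g$ is strictly monotone ($\mathfrak g(A)<\mathfrak g(B)$ for $A\subsetneq B$). Write $x(S)=\sum_{u\in S}x_u$ and put $$\mathcal B^{\ge}_{\mathfrak f}=\{x\in\mathbb R^V_{\ge0}: x(V)=\mathfrak f(V),\ x(S)\ge \mathfrak f(S)\ \forall S\subseteq V\},\qquad \mathcal B^{\le}_{\mathfrak g}=\{y\in\mathbb R^V_{\ge0}: y(V)=\mathfrak g(V),\ y(S)\le \mathfrak g(S)\ \forall S\subseteq V\}.$$ An *allocation* is a pair $(x,y)\in\mathcal B^{\ge}_{\mathfrak f}\times\mathcal B^{\le}_{\mathfrak g}$ (all $y_u$ are then positive). It is *locally maximin* if for every $r>0$ the set $S^{(r)}=\{v\in V: x_v/y_v\ge r\}$ satisfies $x(S^{(r)})=\mathfrak f(S^{(r)})$ and $y(S^{(r)})=\mathfrak g(S^{(r)})$. For $\vartheta:\mathbb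 R_{\ge0}\to\mathbb R$ convex let $\mathsf D_\vartheta(x\|y)=\sum_{u\in V}y_u\,\vartheta(x_u/y_u)$; a *minimizer* is an allocation that minimizes $\mathsf D_\vartheta$ over $\mathcal B^{\ge}_{\mathfrak f}\times\mathcal B^{\le}_{\mathfrak g}$. For a permutation $\sigma$ of $V$ and a set function $h$ let $h^\sigma_u=h(\{u\}\cup P)-h(P)$ with $P=\{w: w\prec_\sigma u\}$, and for a probability distribution $\mathbf p$ on the permutations let $h^{\mathbf p}=\sum_\sigma p_\sigma h^\sigma$. A *solution* is a pair $(\mathbf p,\mathbf q)$ of such distributions; its densities are $\rho^{(\mathbf p,\mathbf q)}_u=\mathfrak f^{\mathbf p}_u/\mathfrak g^{\mathbf q}_u$. It is *optimal* if it minimizes $\mathsf D_\vartheta(\mathfrak f^{\mathbf p}\|\mathfrak g^{\mathbf q})$ over all solutions, and *locally maximin* if $\rho^{(\mathbf p,\mathbf q)}_u>\rho^{(\mathbf p,\mathbf q)}_v$ implies $u\prec_\sigma v$ for every $\sigma$ with $p_\sigma>0$ or $q_\sigma>0$. The *density vector* $\rho^*\in\mathbb R^V$ is obtained as follows: starting from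 $A=\emptyset$, as long as $A\ne V$, let $S$ be the maximal non-empty subset of $V\setminus A$ that maximizes $\frac{\mathfrak f(S\cup A)-\mathfrak f(A)}{\mathfrak g(S\cup A)-\mathfrak g(A)}$, let $\rho^*_u$ be this maximum for all $u\in S$, and replace $A$ by $A\cup S$. **Theorem.** Let $\vartheta:\mathbb R_{\ge0}\to\mathbb R$ be convex. 1. If $\vartheta$ is strictly convex, then an allocation is a minimizer if and only if it is locally maximin. 2. For every convex $\vartheta$, each locally maximin allocation is a minimizer. 3. For every convex $\vartheta$ there is a distribution $\mathbf p$ such that the solution $(\mathbf p,\mathbf p)$ is optimal and the allocation $(\mathfrak f^{\mathbf p},\mathfrak g^{\mathbf p})$ is a minimizer. 4. If $\vartheta$ is strictly convex, then $\rho^{(\mathbf p,\mathbf q)}=\rho^*$ for every optimal solution $(\mathbf p,\mathbf q)$ (in particular for those with $\mathbf p=\mathbf q$), and $x_u/y_u=\rho^*_u$ for all $u\in V$ for every minimizer $(x,y)$. 5. For every convex $\vartheta$, each locally maximin solution is optimal. -/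

import Mathlib

namespace DualModular

/-- A dual-modular instance `(V; f, g)`: both set functions are non-negative, monotone and vanish
on the empty set; `f` is supermodular, `g` is submodular and strictly monotone. -/
structure IsInstance {V : Type*} [Fintype V] [DecidableEq V] (f g : Finset V → ℝ) : Prop where
  f_nonneg : ∀ S, 0 ≤ f S
  g_nonneg : ∀ S, 0 ≤ g S
  f_empty : f ∅ = 0
  g_empty : g ∅ = 0
  f_mono : Monotone f
  g_strictMono : StrictMono g
  f_supermodular : ∀ A B, f A + f B ≤ f (A ∩ B) + f (A ∪ B)
  g_submodular : ∀ A B, g (A ∩ B) + g (A ∪ B) ≤ g A + g B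

/-- The base contrapolymatroid of `f`. -/
def baseGE {V : Type*} [Fintype V] (f : Finset V → ℝ) : Set (V → ℝ) :=
  {x | (∀ v, 0 ≤ x v) ∧ ∑ v, x v = f Finset.univ ∧ ∀ S : Finset V, f S ≤ ∑ v ∈ S, x v}

/-- The base polymatroid of `g`. -/
def baseLE {V : Type*} [Fintype V] (g : Finset V → ℝ) : Set (V → ℝ) :=
  {y | (∀ v, 0 ≤ y v) ∧ ∑ v, y v = g Finset.univ ∧ ∀ S : Finset V, ∑ v ∈ S, y v ≤ g S}

/-- The divergence `D_θ(x ‖ y) = ∑ y_u θ(x_u / y_u)`. Vectors in the base polymatroid of a strictly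
monotone set function have positive coordinates only, so no convention for `y_u = 0` is needed. -/
noncomputable def divergence {V : Type*} [Fintype V] (θ : ℝ → ℝ) (x y : V → ℝ) : ℝ :=
  ∑ u, y u * θ (x u / y u)

/-- `(x, y)` is an allocation that minimizes `D_θ` among all allocations. -/
def IsMinimizer {V : Type*} [Fintype V] (f g : Finset V → ℝ) (θ : ℝ → ℝ) (x y : V → ℝ) : Prop :=
  x ∈ baseGE f ∧ y ∈ baseLE g ∧
    ∀ x' ∈ baseGE f, ∀ y' ∈ baseLE g, divergence θ x y ≤ divergence θ x' y'

/-- The locally maximin condition for an allocation: for every `r > 0`, the agents with density at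
least `r` together receive the least possible reward and pay the largest possible cost. -/
def IsLocallyMaximin {V : Type*} [Fintype V] (f g : Finset V → ℝ) (x y : V → ℝ) : Prop :=
  ∀ r : ℝ, 0 < r → ∀ S : Finset V, (∀ v, v ∈ S ↔ r ≤ x v / y v) →
    ∑ v ∈ S, x v = f S ∧ ∑ v ∈ S, y v = g S

/-- A permutation of `V`, read as an arrangement of its elements in a row: `σ v` is the position
of `v`, and `u` precedes `v` if `σ u < σ v`. -/
abbrev Arrangement (V : Type*) [Fintype V] : Type _ := V ≃ Fin (Fintype.card V)

/-- The marginal vector `h^σ`: the element `u` gets `h({u} ∪ P) - h(P)`, where `P` is the set of the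
elements that precede `u` in `σ`. -/
def marginal {V : Type*} [Fintype V] [DecidableEq V] (h : Finset V → ℝ) (σ : Arrangement V)
    (u : V) : ℝ :=
  h ({u} ∪ Finset.univ.filter (fun w => σ w < σ u)) - h (Finset.univ.filter (fun w => σ w < σ u))

/-- The mean marginal vector `h^p` of a permutation distribution `p`. -/
noncomputable def meanMarginal {V : Type*} [Fintype V] [DecidableEq V] (h : Finset V → ℝ)
    (p : Arrangement V → ℝ) (u : V) : ℝ :=
  ∑ σ, p σ * marginal h σ u

/-- The density vector induced by a pair `(p, q)` of permutation distributions. -/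
noncomputable def inducedDensity {V : Type*} [Fintype V] [DecidableEq V] (f g : Finset V → ℝ)
    (p q : Arrangement V → ℝ) (u : V) : ℝ :=
  meanMarginal f p u / meanMarginal g q u

/-- `(p, q)` is an optimal solution of the convex program over pairs of permutation
distributions. -/
def IsOptimalSolution {V : Type*} [Fintype V] [DecidableEq V] (f g : Finset V → ℝ) (θ : ℝ → ℝ)
    (p q : Arrangement V → ℝ) : Prop :=
  p ∈ stdSimplex ℝ (Arrangement V) ∧ q ∈ stdSimplex ℝ (Arrangement V) ∧
    ∀ p' ∈ stdSimplex ℝ (Arrangement V), ∀ q' ∈ stdSimplex ℝ (Arrangement V),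
      divergence θ (meanMarginal f p) (meanMarginal g q) ≤
        divergence θ (meanMarginal f p') (meanMarginal g q')

/-- The locally maximin condition for a pair `(p, q)` of permutation distributions: elements of
larger density come earlier in every permutation of positive weight. -/
def IsLocallyMaximinSolution {V : Type*} [Fintype V] [DecidableEq V] (f g : Finset V → ℝ)
    (p q : Arrangement V → ℝ) : Prop :=
  p ∈ stdSimplex ℝ (Arrangement V) ∧ q ∈ stdSimplex ℝ (Arrangement V) ∧
    ∀ u v, inducedDensity f g p q v < inducedDensity f g p q u →
      ∀ σ, (0 < p σ ∨ 0 < q σ) → σ u < σ v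

/-- The marginal density `(f(S ∪ A) - f(A)) / (g(S ∪ A) - g(A))` of `S` given `A`. -/
noncomputable def density {V : Type*} [DecidableEq V] (f g : Finset V → ℝ) (A S : Finset V) : ℝ :=
  (f (S ∪ A) - f A) / (g (S ∪ A) - g A)

/-- `S` is a densest subset of the subinstance on `V \ A` with the marginal set functions. -/
def IsDensest {V : Type*} [Fintype V] [DecidableEq V] (f g : Finset V → ℝ)
    (A S : Finset V) : Prop :=
  S ⊆ Aᶜ ∧ S.Nonempty ∧ ∀ T, T ⊆ Aᶜ → T.Nonempty → density f g A T ≤ density f g A S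

open Classical in
/-- The maximal densest subset of the subinstance on `V \ A`, obtained as the union of all densest
subsets; `isDensest_maxDensest` shows that this union is itself densest. -/
noncomputable def maxDensest {V : Type*} [Fintype V] [DecidableEq V] (f g : Finset V → ℝ)
    (A : Finset V) : Finset V :=
  (Finset.univ.filter (fun S => IsDensest f g A S)).sup id

/-- The union of the first `i` parts of the density decomposition. -/
noncomputable def firstParts {V : Type*} [Fintype V] [DecidableEq V] (f g : Finset V → ℝ) :
    ℕ → Finset V
  | 0 => ∅
  | i + 1 => firstParts f g i ∪ maxDensest f g (firstParts f g i)

/-- The parts of the density decomposition, numbered from `0`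
(empty from the point on where `V` is exhausted). -/
noncomputable def part {V : Type*} [Fintype V] [DecidableEq V] (f g : Finset V → ℝ) (i : ℕ) :
    Finset V :=
  maxDensest f g (firstParts f g i)

/-- The number of the part that contains `u` (there is exactly one, see `existsUnique_mem_part`). -/
noncomputable def partIndex {V : Type*} [Fintype V] [DecidableEq V] (f g : Finset V → ℝ)
    (u : V) : ℕ :=
  sInf {i | u ∈ part f g i}

/-- The density vector `ρ*` of the density decomposition: every element gets the marginal density
of its part given the earlier parts. -/
noncomputable def densityVector {V : Type*} [Fintype V] [DecidableEq V] (f g : Finset V → ℝ)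
    (u : V) : ℝ :=
  density f g (firstParts f g (partIndex f g u)) (part f g (partIndex f g u))

/-! Well-posedness of the density decomposition. -/

theorem marginal_pos {V : Type*} [Fintype V] [DecidableEq V] {f g : Finset V → ℝ}
    (h : IsInstance f g) {A S : Finset V} (hS : S ⊆ Aᶜ) (hne : S.Nonempty) :
    0 < g (S ∪ A) - g A := by
  refine sub_pos.2 (h.g_strictMono ?_)
  obtain ⟨v, hv⟩ := hne
  refine Finset.ssubset_iff_of_subset Finset.subset_union_right |>.2 ⟨v, ?_, ?_⟩
  · simp [hv]
  · simpa using hS hv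

theorem isDensest_union {V : Type*} [Fintype V] [DecidableEq V] {f g : Finset V → ℝ}
    (h : IsInstance f g) {A S T : Finset V} (hS : IsDensest f g A S) (hT : IsDensest f g A T) :
    IsDensest f g A (S ∪ T) := by
  have hU : S ∪ T ⊆ Aᶜ := Finset.union_subset hS.1 hT.1
  have hUne : (S ∪ T).Nonempty := hS.2.1.mono Finset.subset_union_left
  refine ⟨hU, hUne, fun R hR hRne => (hS.2.2 R hR hRne).trans ?_⟩
  set r := density f g A S with hr
  have hTr : density f g A T = r :=
    le_antisymm (hS.2.2 T hT.1 hT.2.1) (hT.2.2 S hS.1 hS.2.1)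
  have e1 : f (S ∪ A) - f A = r * (g (S ∪ A) - g A) := by
    rw [hr, density, div_mul_cancel₀ _ (marginal_pos h hS.1 hS.2.1).ne']
  have e2 : f (T ∪ A) - f A = r * (g (T ∪ A) - g A) := by
    rw [← hTr, density, div_mul_cancel₀ _ (marginal_pos h hT.1 hT.2.1).ne']
  have e3 : f (S ∩ T ∪ A) - f A ≤ r * (g (S ∩ T ∪ A) - g A) := by
    rcases (S ∩ T).eq_empty_or_nonempty with he | hne
    · simp [he]
    · have hs : S ∩ T ⊆ Aᶜ := Finset.inter_subset_left.trans hS.1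
      exact (div_le_iff₀ (marginal_pos h hs hne)).1 (hS.2.2 _ hs hne)
  have hr0 : 0 ≤ r :=
    div_nonneg (sub_nonneg.2 (h.f_mono Finset.subset_union_right))
      (marginal_pos h hS.1 hS.2.1).le
  have hi : (S ∪ A) ∩ (T ∪ A) = S ∩ T ∪ A := by rw [Finset.inter_union_distrib_right]
  have hu : (S ∪ A) ∪ (T ∪ A) = S ∪ T ∪ A := by
    ext; simp only [Finset.mem_union]; tauto
  have hf := h.f_supermodular (S ∪ A) (T ∪ A)
  have hg := h.g_submodular (S ∪ A) (T ∪ A)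
  rw [hi, hu] at hf hg
  refine (le_div_iff₀ (marginal_pos h hU hUne)).2 ?_
  have := mul_le_mul_of_nonneg_left hg hr0
  linarith

/-- The maximal densest subset is densest. -/
theorem isDensest_maxDensest {V : Type*} [Fintype V] [DecidableEq V] {f g : Finset V → ℝ}
    (h : IsInstance f g) {A : Finset V} (hA : A ≠ Finset.univ) :
    IsDensest f g A (maxDensest f g A) := by
  classical
  have hne : (Aᶜ).Nonempty := by
    rw [Finset.nonempty_iff_ne_empty]; simpa using hA
  obtain ⟨S, hS, hmax⟩ := Finset.exists_max_image
    ((Aᶜ).powerset.filter Finset.Nonempty) (density f g A) ⟨Aᶜ, by simp [hne]⟩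
  rw [Finset.mem_filter, Finset.mem_powerset] at hS
  have hD : IsDensest f g A S :=
    ⟨hS.1, hS.2, fun T hT hTn => hmax T (by simp [hT, hTn])⟩
  have hmem : S ∈ Finset.univ.filter (fun S => IsDensest f g A S) := by simp [hD]
  rw [maxDensest, ← Finset.sup'_eq_sup ⟨S, hmem⟩]
  refine Finset.sup'_induction _ _ (p := IsDensest f g A)
    (fun _ ha _ hb => isDensest_union h ha hb) ?_
  intro T hT
  simpa using hT

/-- The maximal densest subset contains all densest subsets. -/
theorem subset_maxDensest {V : Type*} [Fintype V] [DecidableEq V] {f g : Finset V → ℝ}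
    {A S : Finset V} (hS : IsDensest f g A S) : S ⊆ maxDensest f g A := by
  classical
  exact Finset.le_sup (f := id) (by simpa using hS)

/-- The parts of the density decomposition partition the ground set. -/
theorem existsUnique_mem_part {V : Type*} [Fintype V] [DecidableEq V] {f g : Finset V → ℝ}
    (h : IsInstance f g) (u : V) : ∃! i, u ∈ part f g i := by
  classical
  have hsub : ∀ A, maxDensest f g A ⊆ Aᶜ := by
    intro A
    refine Finset.sup_le fun S hS => ?_
    exact (Finset.mem_filter.1 hS).2.1
  have hmono : Monotone (firstParts f g) :=
    monotone_nat_of_le_succ fun i => Finset.subset_union_left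
  have hcard : ∀ i, firstParts f g i = Finset.univ ∨ i ≤ (firstParts f g i).card := by
    intro i
    induction i with
    | zero => right; simp
    | succ i ih =>
      by_cases hU : firstParts f g i = Finset.univ
      · left
        exact Finset.univ_subset_iff.1 (hU ▸ hmono (Nat.le_succ i))
      · right
        have hd := isDensest_maxDensest h hU
        have hdis : Disjoint (firstParts f g i) (maxDensest f g (firstParts f g i)) := by
          rw [Finset.disjoint_right]
          intro a ha
          simpa using hsub _ ha
        have hc : (firstParts f g (i + 1)).card =
            (firstParts f g i).card + (maxDensest f g (firstParts f g i)).card :=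
          Finset.card_union_of_disjoint hdis
        have := hd.2.1.card_pos
        have := ih.resolve_left hU
        omega
  have hex : ∃ i, u ∈ firstParts f g i := by
    refine ⟨Fintype.card V, ?_⟩
    rcases hcard (Fintype.card V) with hU | hc
    · simp [hU]
    · rw [(Finset.card_eq_iff_eq_univ _).1 (le_antisymm (Finset.card_le_univ _) hc)]
      exact Finset.mem_univ u
  have hlt : ∀ i j, i < j → u ∈ part f g i → u ∉ part f g j := by
    intro i j hij hi hj
    have h1 : u ∈ firstParts f g (i + 1) := Finset.mem_union_right _ hi
    have h2 := hmono (Nat.succ_le_of_lt hij) h1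
    have h3 := hsub _ hj
    exact (Finset.mem_compl.1 h3) h2
  have hn : ∃ i, u ∈ part f g i := by
    obtain ⟨i, hi⟩ := hex
    induction i with
    | zero => simp [firstParts] at hi
    | succ i ih =>
      rcases Finset.mem_union.1 hi with h1 | h1
      · exact ih h1
      · exact ⟨i, h1⟩
  obtain ⟨i, hi⟩ := hn
  refine ⟨i, hi, fun j hj => ?_⟩
  rcases lt_trichotomy i j with hij | hij | hij
  · exact absurd hj (hlt i j hij hi)
  · exact hij.symm
  · exact absurd hi (hlt j i hij hj)

end DualModular

/-! Let `(x, y)` be locally maximin with densities ρ = x/y, and let s(r) be the slope and -c(r) the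
value at 0 of a support line of θ at r. For an allocation `(x', y')` with densities τ, D(x'‖y') -
D(x‖y) is exactly the sum of ∑ y'(θ(τ) - support line at ρ, evaluated at τ), ∑ s(ρ)(x' - x) and ∑
c(ρ)(y - y'). The first is non-negative by convexity. For the others, s and c are monotone in the
density, and on each superlevel set of ρ the constraints are tight for `(x, y)`, so x' has at least
the mass of x and y' at most that of y; Abel summation applies. If θ is strictly convex, equality
forces τ = ρ and tightness of `(x', y')` (`IsLocallyMaximin.divergence_le`).

Everything then follows from one locally maximin pair (f^p, g^p). It comes from the case θ(t) = t²:
minimize ∑ (f^p)²/g^p over the compact simplex and perturb towards the permutation sorted by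
decreasing density, whose marginals are tight on all superlevel sets (`exists_isLocallyMaximin`).
Locally maximin densities equal ρ* because each level set of the density is the next maximal densest
set (`IsLocallyMaximin.maxDensest_eq`). -/

namespace DualModular

/-! ### Abel summation over superlevel sets -/

/-- Abel summation over the superlevel sets of a non-negative weight. -/
theorem sum_mul_nonneg_of_levels {V : Type*} [Fintype V] {d : V → ℝ} :
    ∀ (n : ℕ) (w : V → ℝ), (Finset.univ.filter (fun u => 0 < w u)).card = n → (∀ u, 0 ≤ w u) →
      (∀ t, 0 < t → 0 ≤ ∑ u with t ≤ w u, d u) →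
      0 ≤ ∑ u, w u * d u ∧
        (∑ u, w u * d u = 0 → ∀ t, 0 < t → ∑ u with t ≤ w u, d u = 0) := by
  intro n
  induction n using Nat.strong_induction_on with
  | _ n ih =>
    intro w hn hw hd
    rcases (Finset.univ.filter (fun u => 0 < w u)).eq_empty_or_nonempty with he | hne
    · have h0 : ∀ u, w u = 0 := fun u => by
        by_contra hu
        have : u ∈ Finset.univ.filter (fun u => 0 < w u) := by
          simpa using lt_of_le_of_ne (hw u) (Ne.symm hu)
        simp [he] at this
      refine ⟨by simp [h0], fun _ t ht => ?_⟩
      simp [h0, not_le.2 ht]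
    · obtain ⟨a, ha, hmin⟩ := Finset.exists_min_image _ w hne
      have hm : 0 < w a := by simpa using ha
      have hmin' : ∀ u, 0 < w u → w a ≤ w u := fun u hu => hmin u (by simpa using hu)
      have hw' : ∀ u, 0 ≤ max (w u - w a) 0 := fun u => le_max_right _ _
      have hlev : ∀ t, 0 < t → ∀ u, t ≤ max (w u - w a) 0 ↔ t + w a ≤ w u := by
        intro t ht u
        rw [le_max_iff, le_sub_iff_add_le]
        simp [not_le.2 ht]
      have hcard : (Finset.univ.filter (fun u => 0 < max (w u - w a) 0)).card < n := by
        rw [← hn]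
        refine Finset.card_lt_card (Finset.ssubset_iff_of_subset ?_ |>.2 ⟨a, ha, by simp⟩)
        intro u hu
        simp only [Finset.mem_filter, Finset.mem_univ, true_and, lt_max_iff, lt_self_iff_false,
          or_false] at hu ⊢
        linarith
      obtain ⟨h1, h2⟩ := ih _ hcard (fun u => max (w u - w a) 0) rfl hw' (fun t ht => by
        simp only [hlev t ht]
        exact hd _ (by linarith))
      have hsplit : ∑ u, w u * d u =
          ∑ u, max (w u - w a) 0 * d u + w a * ∑ u with w a ≤ w u, d u := by
        rw [Finset.sum_filter, Finset.mul_sum, ← Finset.sum_add_distrib]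
        refine Finset.sum_congr rfl fun u _ => ?_
        split_ifs with hu
        · rw [max_eq_left (by linarith)]; ring
        · have : w u = 0 := le_antisymm (not_lt.1 fun hu' => hu (hmin' u hu')) (hw u)
          rw [max_eq_right (by linarith), this]; ring
      have h3 := hd _ hm
      have h4 := mul_nonneg hm.le h3
      refine ⟨by linarith, fun hz t ht => ?_⟩
      have h5 : ∑ u, max (w u - w a) 0 * d u = 0 := by linarith
      have h6 : ∑ u with w a ≤ w u, d u = 0 := by
        have : w a * ∑ u with w a ≤ w u, d u = 0 := by linarith
        exact (mul_eq_zero.1 this).resolve_left hm.ne'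
      rcases le_or_gt t (w a) with hta | hta
      · rw [← h6]
        congr 1
        ext u
        simp only [Finset.mem_filter, Finset.mem_univ, true_and]
        exact ⟨fun h => hmin' u (by linarith), fun h => by linarith⟩
      · have := h2 h5 (t - w a) (by linarith)
        simp only [hlev (t - w a) (by linarith)] at this
        simpa using this

/-- A monotone reweighting of `ρ` pairs non-negatively with every vector of sum zero whose sums
over the superlevel sets of `ρ` are non-negative. -/
theorem sum_comp_mul_nonneg {V : Type*} [Fintype V] {d ρ : V → ℝ} {φ : ℝ → ℝ}
    (hφ : ∀ u v, ρ u ≤ ρ v → φ (ρ u) ≤ φ (ρ v)) (h0 : ∑ u, d u = 0)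
    (hd : ∀ r, 0 ≤ ∑ u with r ≤ ρ u, d u) :
    0 ≤ ∑ u, φ (ρ u) * d u ∧
      ((∀ u v, ρ u < ρ v → φ (ρ u) < φ (ρ v)) → ∑ u, φ (ρ u) * d u = 0 →
        ∀ r, ∑ u with r ≤ ρ u, d u = 0) := by
  rcases isEmpty_or_nonempty V with hV | hV
  · simp
  obtain ⟨a, -, ha⟩ := Finset.exists_min_image Finset.univ (fun u => φ (ρ u))
    Finset.univ_nonempty
  -- Subtracting the minimum makes the weight non-negative and costs nothing, since d sums to zero.
  have hshift : ∑ u, φ (ρ u) * d u = ∑ u, (φ (ρ u) - φ (ρ a)) * d u := by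
    simp only [sub_mul, Finset.sum_sub_distrib, ← Finset.mul_sum, h0, mul_zero, sub_zero]
  obtain ⟨h1, h2⟩ := sum_mul_nonneg_of_levels (d := d) _ (fun u => φ (ρ u) - φ (ρ a)) rfl
    (fun u => sub_nonneg.2 (ha u (Finset.mem_univ u))) (by
      intro t ht
      rcases (Finset.univ.filter (fun u => t ≤ φ (ρ u) - φ (ρ a))).eq_empty_or_nonempty
        with he | hne
      · rw [he]; simp
      · obtain ⟨v, hv, hmin⟩ := Finset.exists_min_image _ ρ hne
        convert hd (ρ v) using 2
        ext u
        simp only [Finset.mem_filter, Finset.mem_univ, true_and] at hv hmin ⊢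
        exact ⟨hmin u, fun h => by linarith [hφ v u h]⟩)
  rw [hshift]
  refine ⟨h1, fun hs hz r => ?_⟩
  rcases (Finset.univ.filter (fun u => r ≤ ρ u)).eq_empty_or_nonempty with he | hne
  · rw [he]; simp
  · obtain ⟨v, hv, hmin⟩ := Finset.exists_min_image _ ρ hne
    simp only [Finset.mem_filter, Finset.mem_univ, true_and] at hv hmin
    have hset : Finset.univ.filter (fun u => r ≤ ρ u) =
        Finset.univ.filter (fun u => φ (ρ v) - φ (ρ a) ≤ φ (ρ u) - φ (ρ a)) := by
      ext u
      simp only [Finset.mem_filter, Finset.mem_univ, true_and, sub_le_sub_iff_right]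
      refine ⟨fun h => hφ _ _ (hmin u h), fun h => hv.trans (not_lt.1 fun h' => ?_)⟩
      exact absurd (hs _ _ h') (not_lt.2 h)
    rw [hset]
    -- The level lemma covers positive levels only; at the minimum the set is all of V.
    rcases (ha v (Finset.mem_univ v)).eq_or_lt with h | h
    · rw [Finset.filter_true_of_mem, h0]
      intro u _
      have h3 : φ (ρ a) ≤ φ (ρ u) := ha u (Finset.mem_univ u)
      have h4 : φ (ρ a) = φ (ρ v) := h
      linarith
    · exact h2 hz _ (sub_pos.2 h)

/-! ### Support lines -/

/-- Subgradients of a convex function relative to finitely many points. -/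
theorem exists_subgradient {θ : ℝ → ℝ} (hθ : ConvexOn ℝ (Set.Ici 0) θ) (T : Finset ℝ)
    (hT : ∀ t ∈ T, 0 ≤ t) :
    ∃ s : ℝ → ℝ, ∀ r ∈ T, ∀ t ∈ T, θ r + s r * (t - r) ≤ θ t ∧
      (StrictConvexOn ℝ (Set.Ici 0) θ → t ≠ r → θ r + s r * (t - r) < θ t) := by
  have key : ∀ r, ∃ s : ℝ, r ∈ T → ∀ t ∈ T, θ r + s * (t - r) ≤ θ t ∧
      (StrictConvexOn ℝ (Set.Ici 0) θ → t ≠ r → θ r + s * (t - r) < θ t) := by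
    intro r
    by_cases hr : r ∈ T
    swap
    · exact ⟨0, fun h => absurd h hr⟩
    rcases (hT r hr).eq_or_lt with h0 | hpos
    · obtain ⟨m, hm⟩ := (T.image fun t => (θ t - θ 0) / t).bddBelow
      refine ⟨m - 1, fun _ t ht => ?_⟩
      subst h0
      rcases (hT t ht).eq_or_lt with h | h
      · subst h; simp
      · have h1 : m ≤ (θ t - θ 0) / t := hm (by simpa using ⟨t, ht, rfl⟩)
        rw [le_div_iff₀ h] at h1
        exact ⟨by nlinarith, fun _ _ => by nlinarith⟩
    · have hint : r ∈ interior (Set.Ici (0 : ℝ)) := by simpa using hpos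
      set s := derivWithin θ (Set.Ioi r) r
      have hsup : ∀ t, 0 ≤ t → θ r + s * (t - r) ≤ θ t := by
        intro t ht
        rcases lt_trichotomy t r with h | h | h
        · have h1 := (hθ.slope_le_leftDeriv_of_mem_interior (Set.mem_Ici.2 ht) hint h).trans
            (hθ.leftDeriv_le_rightDeriv_of_mem_interior hint)
          rw [slope_def_field, div_le_iff₀ (sub_pos.2 h)] at h1
          linarith
        · subst h; simp
        · have h1 := hθ.rightDeriv_le_slope_of_mem_interior hint (Set.mem_Ici.2 ht) h
          rw [slope_def_field, le_div_iff₀ (sub_pos.2 h)] at h1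
          linarith
      refine ⟨s, fun _ t ht => ⟨hsup t (hT t ht), fun hs hne => ?_⟩⟩
      -- If the line touched θ at t too, strict convexity would put θ below the line at the
      -- midpoint.
      have h1 := hs.2 (Set.mem_Ici.2 (hT t ht)) (Set.mem_Ici.2 hpos.le) hne
        (by norm_num : (0 : ℝ) < 1 / 2) (by norm_num : (0 : ℝ) < 1 / 2) (by norm_num)
      simp only [smul_eq_mul] at h1
      have h2 := hsup (1 / 2 * t + 1 / 2 * r) (by linarith [hT t ht])
      linarith
  choose s hs using key
  exact ⟨s, fun r hr => hs r hr⟩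

/-! ### Marginal vectors and base polytopes -/

/-- The sum telescopes along the order that σ induces on S: dropping the last element changes no
other prefix. -/
theorem sum_sub_prefix_inter {V : Type*} [Fintype V] [DecidableEq V] (h : Finset V → ℝ)
    (h0 : h ∅ = 0) (σ : Arrangement V) (S : Finset V) :
    ∑ u ∈ S, (h ({u} ∪ S.filter (fun w => σ w < σ u)) - h (S.filter (fun w => σ w < σ u))) =
      h S := by
  induction S using Finset.induction_on_max_value σ with
  | empty => simp [h0]
  | insert a s ha hmax ih =>
    have hlt : ∀ x ∈ s, σ x < σ a := fun x hx =>
      lt_of_le_of_ne (hmax x hx) fun he => ha (σ.injective he ▸ hx)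
    have h1 : (insert a s).filter (fun w => σ w < σ a) = s := by
      ext x
      simp only [Finset.mem_filter, Finset.mem_insert]
      constructor
      · rintro ⟨rfl | hx, hlt'⟩
        · exact absurd hlt' (lt_irrefl _)
        · exact hx
      · exact fun hx => ⟨Or.inr hx, hlt x hx⟩
    have h2 : ∀ u ∈ s, (insert a s).filter (fun w => σ w < σ u) =
        s.filter (fun w => σ w < σ u) := by
      intro u hu
      rw [Finset.filter_insert, if_neg (not_lt.2 (hlt u hu).le)]
    rw [Finset.sum_insert ha, h1, Finset.sum_congr rfl fun u hu => by rw [h2 u hu], ih,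
      ← Finset.insert_eq]
    ring

theorem sum_marginal_of_initial {V : Type*} [Fintype V] [DecidableEq V] {h : Finset V → ℝ}
    (h0 : h ∅ = 0) {σ : Arrangement V} {S : Finset V}
    (hS : ∀ u ∈ S, ∀ v, v ∉ S → σ u < σ v) : ∑ u ∈ S, marginal h σ u = h S := by
  rw [← sum_sub_prefix_inter h h0 σ S]
  refine Finset.sum_congr rfl fun u hu => ?_
  have : Finset.univ.filter (fun w => σ w < σ u) = S.filter (fun w => σ w < σ u) := by
    ext w
    simp only [Finset.mem_filter, Finset.mem_univ, true_and]
    refine ⟨fun hw => ⟨?_, hw⟩, fun hw => hw.2⟩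
    by_contra hwS
    exact lt_asymm hw (hS u hu w hwS)
  rw [marginal, this]

theorem marginal_neg {V : Type*} [Fintype V] [DecidableEq V] (h : Finset V → ℝ)
    (σ : Arrangement V) (u : V) : marginal (fun S => -h S) σ u = -marginal h σ u := by
  simp only [marginal]; ring

/-- By supermodularity a marginal can only grow when the prefix grows from S ∩ P to P, and the
marginals over S ∩ P telescope to h S. -/
theorem le_sum_marginal {V : Type*} [Fintype V] [DecidableEq V] {h : Finset V → ℝ}
    (h0 : h ∅ = 0) (hsup : ∀ A B, h A + h B ≤ h (A ∩ B) + h (A ∪ B)) (σ : Arrangement V)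
    (S : Finset V) : h S ≤ ∑ u ∈ S, marginal h σ u := by
  rw [← sum_sub_prefix_inter h h0 σ S]
  refine Finset.sum_le_sum fun u hu => ?_
  have h1 := hsup ({u} ∪ S.filter (fun w => σ w < σ u)) (Finset.univ.filter (fun w => σ w < σ u))
  have hi : ({u} ∪ S.filter (fun w => σ w < σ u)) ∩ Finset.univ.filter (fun w => σ w < σ u) =
      S.filter (fun w => σ w < σ u) := by
    ext w
    simp only [Finset.mem_inter, Finset.mem_union, Finset.mem_singleton, Finset.mem_filter,
      Finset.mem_univ, true_and]
    constructor
    · rintro ⟨rfl | hw, hlt⟩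
      · exact absurd hlt (lt_irrefl _)
      · exact hw
    · exact fun hw => ⟨Or.inr hw, hw.2⟩
  have hu : ({u} ∪ S.filter (fun w => σ w < σ u)) ∪ Finset.univ.filter (fun w => σ w < σ u) =
      {u} ∪ Finset.univ.filter (fun w => σ w < σ u) := by
    ext w
    simp only [Finset.mem_union, Finset.mem_singleton, Finset.mem_filter,
      Finset.mem_univ, true_and]
    tauto
  rw [hi, hu] at h1
  rw [marginal]
  linarith

section MeanMarginal

variable {V : Type*} [Fintype V] [DecidableEq V] {p : Arrangement V → ℝ}

theorem sum_meanMarginal (h : Finset V → ℝ) (p : Arrangement V → ℝ) (S : Finset V) :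
    ∑ u ∈ S, meanMarginal h p u = ∑ σ, p σ * ∑ u ∈ S, marginal h σ u := by
  simp only [meanMarginal, Finset.mul_sum]
  exact Finset.sum_comm

theorem sum_meanMarginal_of_initial {h : Finset V → ℝ} (h0 : h ∅ = 0)
    (hp : p ∈ stdSimplex ℝ (Arrangement V)) {S : Finset V}
    (hS : ∀ σ, 0 < p σ → ∀ u ∈ S, ∀ v, v ∉ S → σ u < σ v) :
    ∑ u ∈ S, meanMarginal h p u = h S := by
  rw [sum_meanMarginal]
  calc ∑ σ, p σ * ∑ u ∈ S, marginal h σ u = ∑ σ, p σ * h S := by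
        refine Finset.sum_congr rfl fun σ _ => ?_
        rcases (hp.1 σ).eq_or_lt with h | h
        · simp [← h]
        · rw [sum_marginal_of_initial h0 (hS σ h)]
    _ = h S := by rw [← Finset.sum_mul, hp.2, one_mul]

theorem meanMarginal_nonneg {h : Finset V → ℝ} (hmono : Monotone h)
    (hp : p ∈ stdSimplex ℝ (Arrangement V)) (u : V) : 0 ≤ meanMarginal h p u :=
  Finset.sum_nonneg fun σ _ =>
    mul_nonneg (hp.1 σ) (sub_nonneg.2 (hmono Finset.subset_union_right))

theorem meanMarginal_mem_baseGE {f g : Finset V → ℝ} (hfg : IsInstance f g)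
    (hp : p ∈ stdSimplex ℝ (Arrangement V)) : meanMarginal f p ∈ baseGE f := by
  refine ⟨meanMarginal_nonneg hfg.f_mono hp,
    sum_meanMarginal_of_initial hfg.f_empty hp fun σ _ u _ v hv => absurd (Finset.mem_univ v) hv,
    fun S => ?_⟩
  rw [sum_meanMarginal]
  calc f S = ∑ σ, p σ * f S := by rw [← Finset.sum_mul, hp.2, one_mul]
    _ ≤ _ := Finset.sum_le_sum fun σ _ => mul_le_mul_of_nonneg_left
        (le_sum_marginal hfg.f_empty hfg.f_supermodular σ S) (hp.1 σ)

theorem meanMarginal_mem_baseLE {f g : Finset V → ℝ} (hfg : IsInstance f g)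
    (hp : p ∈ stdSimplex ℝ (Arrangement V)) : meanMarginal g p ∈ baseLE g := by
  refine ⟨meanMarginal_nonneg hfg.g_strictMono.monotone hp,
    sum_meanMarginal_of_initial hfg.g_empty hp fun σ _ u _ v hv => absurd (Finset.mem_univ v) hv,
    fun S => ?_⟩
  rw [sum_meanMarginal]
  calc _ ≤ ∑ σ, p σ * g S := Finset.sum_le_sum fun σ _ => mul_le_mul_of_nonneg_left (by
          -- Submodularity of g is supermodularity of -g.
          have h1 := le_sum_marginal (h := fun S => -g S) (by simp [hfg.g_empty])
            (fun A B => by linarith [hfg.g_submodular A B]) σ S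
          simp only [marginal_neg, Finset.sum_neg_distrib] at h1
          linarith) (hp.1 σ)
    _ = g S := by rw [← Finset.sum_mul, hp.2, one_mul]

end MeanMarginal

/-- y_u = g(V) - y(V \ {u}) ≥ g(V) - g(V \ {u}) > 0. -/
theorem baseLE_pos {V : Type*} [Fintype V] [DecidableEq V] {f g : Finset V → ℝ}
    (hfg : IsInstance f g) {y : V → ℝ} (hy : y ∈ baseLE g) (u : V) : 0 < y u := by
  have h1 := hy.2.2 (Finset.univ.erase u)
  have h2 := Finset.add_sum_erase Finset.univ y (Finset.mem_univ u)
  have h3 := hfg.g_strictMono (Finset.erase_ssubset (Finset.mem_univ u))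
  linarith [hy.2.1]

theorem div_nonneg_of_mem_base {V : Type*} [Fintype V] {f g : Finset V → ℝ} {x y : V → ℝ}
    (hx : x ∈ baseGE f) (hy : y ∈ baseLE g) (u : V) : 0 ≤ x u / y u :=
  div_nonneg (hx.1 u) (hy.1 u)

theorem IsLocallyMaximin.of_tight {V : Type*} [Fintype V] {f g : Finset V → ℝ} {x y : V → ℝ}
    (h : ∀ r, ∑ v with r ≤ x v / y v, x v = f (Finset.univ.filter fun v => r ≤ x v / y v) ∧
      ∑ v with r ≤ x v / y v, y v = g (Finset.univ.filter fun v => r ≤ x v / y v)) :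
    IsLocallyMaximin f g x y := by
  intro r _ S hS
  have : S = Finset.univ.filter fun v => r ≤ x v / y v := by ext v; simp [hS]
  rw [this]
  exact h r

/-- In a locally maximin allocation, all superlevel sets of the density are tight. -/
theorem IsLocallyMaximin.tight {V : Type*} [Fintype V] {f g : Finset V → ℝ} {x y : V → ℝ}
    (h : IsLocallyMaximin f g x y) (hx : x ∈ baseGE f)
    (hy : y ∈ baseLE g) (r : ℝ) :
    ∑ v with r ≤ x v / y v, x v = f (Finset.univ.filter fun v => r ≤ x v / y v) ∧
      ∑ v with r ≤ x v / y v, y v = g (Finset.univ.filter fun v => r ≤ x v / y v) := by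
  rcases le_or_gt r 0 with hr | hr
  · rw [Finset.filter_true_of_mem fun v _ => hr.trans (div_nonneg_of_mem_base hx hy v)]
    exact ⟨hx.2.1, hy.2.1⟩
  · exact h r hr _ (by simp)

/-! ### Locally maximin allocations: optimality and densities -/

section Allocation

variable {V : Type*} [Fintype V] [DecidableEq V] {f g : Finset V → ℝ} {x y x' y' : V → ℝ}

/-- A locally maximin allocation has the least divergence; for strictly convex `θ`, every other
allocation of the same divergence has the same densities and is locally maximin. -/
theorem IsLocallyMaximin.divergence_le (hfg : IsInstance f g) {θ : ℝ → ℝ}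
    (hθ : ConvexOn ℝ (Set.Ici 0) θ) (h : IsLocallyMaximin f g x y) (hx : x ∈ baseGE f)
    (hy : y ∈ baseLE g) (hx' : x' ∈ baseGE f) (hy' : y' ∈ baseLE g) :
    divergence θ x y ≤ divergence θ x' y' ∧
      (StrictConvexOn ℝ (Set.Ici 0) θ → divergence θ x' y' ≤ divergence θ x y →
        (∀ u, x' u / y' u = x u / y u) ∧ IsLocallyMaximin f g x' y') := by
  set ρ : V → ℝ := fun u => x u / y u with hρ
  set τ : V → ℝ := fun u => x' u / y' u with hτ
  obtain ⟨s, hs⟩ := exists_subgradient hθ (Finset.univ.image ρ ∪ Finset.univ.image τ) (by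
    intro t ht
    simp only [Finset.mem_union, Finset.mem_image, Finset.mem_univ, true_and] at ht
    rcases ht with ⟨u, rfl⟩ | ⟨u, rfl⟩
    · exact div_nonneg_of_mem_base hx hy u
    · exact div_nonneg_of_mem_base hx' hy' u)
  have hρT : ∀ u, ρ u ∈ Finset.univ.image ρ ∪ Finset.univ.image τ := fun u =>
    Finset.mem_union_left _ (Finset.mem_image_of_mem _ (Finset.mem_univ u))
  have hτT : ∀ u, τ u ∈ Finset.univ.image ρ ∪ Finset.univ.image τ := fun u =>
    Finset.mem_union_right _ (Finset.mem_image_of_mem _ (Finset.mem_univ u))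
  have hρ0 : ∀ u, 0 ≤ ρ u := div_nonneg_of_mem_base hx hy
  have hy0 := baseLE_pos hfg hy
  have hy0' := baseLE_pos hfg hy'
  have hxρ : ∀ u, x u = ρ u * y u := fun u => (div_mul_cancel₀ _ (hy0 u).ne').symm
  have hxτ : ∀ u, x' u = τ u * y' u := fun u => (div_mul_cancel₀ _ (hy0' u).ne').symm
  -- the slopes and the intercepts of the support lines are monotone
  have hsm : ∀ u v, ρ u < ρ v → s (ρ u) ≤ s (ρ v) := by
    intro u v huv
    have h1 := (hs _ (hρT u) _ (hρT v)).1
    have h2 := (hs _ (hρT v) _ (hρT u)).1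
    nlinarith
  have hsm' : StrictConvexOn ℝ (Set.Ici 0) θ → ∀ u v, ρ u < ρ v → s (ρ u) < s (ρ v) := by
    intro hst u v huv
    have h1 := (hs _ (hρT u) _ (hρT v)).2 hst huv.ne'
    have h2 := (hs _ (hρT v) _ (hρT u)).2 hst huv.ne
    nlinarith
  -- Minus the support line's value at 0. It is monotone because the contact points are
  -- non-negative.
  set c : ℝ → ℝ := fun r => s r * r - θ r with hc
  have hcm : ∀ u v, ρ u < ρ v → c (ρ u) ≤ c (ρ v) := by
    intro u v huv
    have h1 := (hs _ (hρT u) _ (hρT v)).1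
    have h2 := (hs _ (hρT v) _ (hρT u)).1
    have h3 := mul_le_mul_of_nonneg_left (hsm u v huv) (hρ0 u)
    simp only [hc]
    nlinarith
  have hcm' : StrictConvexOn ℝ (Set.Ici 0) θ → ∀ u v, ρ u < ρ v → c (ρ u) < c (ρ v) := by
    intro hst u v huv
    have h2 := (hs _ (hρT v) _ (hρT u)).2 hst huv.ne
    have h3 := mul_le_mul_of_nonneg_left (hsm u v huv) (hρ0 u)
    simp only [hc]
    nlinarith
  have weak : ∀ φ : ℝ → ℝ, (∀ u v, ρ u < ρ v → φ (ρ u) ≤ φ (ρ v)) →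
      ∀ u v, ρ u ≤ ρ v → φ (ρ u) ≤ φ (ρ v) := by
    intro φ hφ u v huv
    rcases huv.eq_or_lt with he | hl
    · rw [he]
    · exact hφ u v hl
  obtain ⟨hA, hA'⟩ := sum_comp_mul_nonneg (d := fun u => x' u - x u) (weak s hsm)
    (by rw [Finset.sum_sub_distrib, hx.2.1, hx'.2.1, sub_self]) (fun r => by
      rw [Finset.sum_sub_distrib, (h.tight hx hy r).1]
      exact sub_nonneg.2 (hx'.2.2 _))
  obtain ⟨hB, hB'⟩ := sum_comp_mul_nonneg (d := fun u => y u - y' u) (weak c hcm)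
    (by rw [Finset.sum_sub_distrib, hy.2.1, hy'.2.1, sub_self]) (fun r => by
      rw [Finset.sum_sub_distrib, (h.tight hx hy r).2]
      exact sub_nonneg.2 (hy'.2.2 _))
  have hC : ∀ u, 0 ≤ y' u * (θ (τ u) - (θ (ρ u) + s (ρ u) * (τ u - ρ u))) := fun u =>
    mul_nonneg (hy0' u).le (sub_nonneg.2 (hs _ (hρT u) _ (hτT u)).1)
  have hsplit : divergence θ x' y' - divergence θ x y =
      ∑ u, y' u * (θ (τ u) - (θ (ρ u) + s (ρ u) * (τ u - ρ u))) +
        ∑ u, s (ρ u) * (x' u - x u) + ∑ u, c (ρ u) * (y u - y' u) := by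
    simp only [divergence]
    rw [← Finset.sum_sub_distrib, ← Finset.sum_add_distrib, ← Finset.sum_add_distrib]
    refine Finset.sum_congr rfl fun u _ => ?_
    change y' u * θ (τ u) - y u * θ (ρ u) = _
    rw [hxρ u, hxτ u]
    simp only [hc]
    ring
  have hC0 := Finset.sum_nonneg fun u (_ : u ∈ Finset.univ) => hC u
  refine ⟨by linarith, fun hst hle => ?_⟩
  have hτρ : ∀ u, τ u = ρ u := by
    intro u
    by_contra hne
    have h1 : ∑ u, y' u * (θ (τ u) - (θ (ρ u) + s (ρ u) * (τ u - ρ u))) = 0 := by linarith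
    have h2 := (Finset.sum_eq_zero_iff_of_nonneg fun u _ => hC u).1 h1 u (Finset.mem_univ u)
    exact (mul_pos (hy0' u) (sub_pos.2 ((hs _ (hρT u) _ (hτT u)).2 hst hne))).ne' h2
  -- The two Abel sums vanish as well, and s and c are strictly monotone on the densities, so x' and
  -- y' have the masses of x and y on every superlevel set.
  refine ⟨hτρ, IsLocallyMaximin.of_tight fun r => ?_⟩
  have h1 := hA' (hsm' hst) (by linarith) r
  have h2 := hB' (hcm' hst) (by linarith) r
  rw [Finset.sum_sub_distrib] at h1 h2
  have hset : (Finset.univ.filter fun v => r ≤ x' v / y' v) =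
      Finset.univ.filter fun v => r ≤ x v / y v :=
    Finset.filter_congr fun v _ => by
      change r ≤ τ v ↔ r ≤ ρ v
      rw [hτρ v]
  rw [hset, ← (h.tight hx hy r).1, ← (h.tight hx hy r).2]
  exact ⟨by linarith, by linarith⟩

theorem IsLocallyMaximin.isMinimizer (hfg : IsInstance f g) {θ : ℝ → ℝ}
    (hθ : ConvexOn ℝ (Set.Ici 0) θ) (h : IsLocallyMaximin f g x y) (hx : x ∈ baseGE f)
    (hy : y ∈ baseLE g) : IsMinimizer f g θ x y :=
  ⟨hx, hy, fun _ hx' _ hy' => (h.divergence_le hfg hθ hx hy hx' hy').1⟩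

/-- The elements of largest density outside a tight upper set form the maximal densest subset. -/
theorem IsLocallyMaximin.maxDensest_eq (hfg : IsInstance f g) (h : IsLocallyMaximin f g x y)
    (hx : x ∈ baseGE f) (hy : y ∈ baseLE g) {A : Finset V} (hA : A ≠ Finset.univ)
    (hup : ∀ u ∈ A, ∀ v, v ∉ A → x v / y v < x u / y u)
    (hxA : ∑ v ∈ A, x v = f A) (hyA : ∑ v ∈ A, y v = g A) :
    (∀ u ∈ maxDensest f g A, ∀ v, v ∉ A → v ∉ maxDensest f g A → x v / y v < x u / y u) ∧
      (∀ u ∈ maxDensest f g A, x u / y u = density f g A (maxDensest f g A)) ∧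
      ∑ v ∈ A ∪ maxDensest f g A, x v = f (A ∪ maxDensest f g A) ∧
      ∑ v ∈ A ∪ maxDensest f g A, y v = g (A ∪ maxDensest f g A) := by
  have hne : (Aᶜ).Nonempty := by rw [Finset.nonempty_iff_ne_empty]; simpa using hA
  obtain ⟨a, ha, hmax⟩ := Finset.exists_max_image _ (fun u => x u / y u) hne
  set m := x a / y a with hm
  have hy0 := baseLE_pos hfg hy
  have hm0 : 0 ≤ m := div_nonneg_of_mem_base hx hy a
  rw [Finset.mem_compl] at ha
  have hmax' : ∀ v, v ∉ A → x v / y v ≤ m := fun v hv => hmax v (Finset.mem_compl.2 hv)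
  set S := Aᶜ.filter (fun v => m ≤ x v / y v) with hS
  have hSm : ∀ v, v ∈ S ↔ v ∉ A ∧ x v / y v = m := by
    intro v
    simp only [hS, Finset.mem_filter, Finset.mem_compl]
    exact ⟨fun hv => ⟨hv.1, le_antisymm (hmax' v hv.1) hv.2⟩, fun hv => ⟨hv.1, hv.2.ge⟩⟩
  have hSA : Disjoint A S := by
    rw [Finset.disjoint_right]
    exact fun v hv => ((hSm v).1 hv).1
  -- A ∪ S is a full superlevel set of the density, hence tight.
  have hlev : (Finset.univ.filter fun v => m ≤ x v / y v) = A ∪ S := by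
    ext v
    simp only [Finset.mem_filter, Finset.mem_univ, true_and, Finset.mem_union, hS,
      Finset.mem_compl]
    constructor
    · intro hv
      by_cases hvA : v ∈ A
      · exact Or.inl hvA
      · exact Or.inr ⟨hvA, hv⟩
    · rintro (hv | hv)
      · exact (hup v hv a ha).le
      · exact hv.2
  have htight := h.tight hx hy m
  rw [hlev] at htight
  have hxS : ∑ v ∈ S, x v = m * ∑ v ∈ S, y v := by
    rw [Finset.mul_sum]
    refine Finset.sum_congr rfl fun v hv => ?_
    rw [← ((hSm v).1 hv).2, div_mul_cancel₀ _ (hy0 v).ne']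
  have hSsub : S ⊆ Aᶜ := Finset.filter_subset _ _
  have hSne : S.Nonempty := ⟨a, (hSm a).2 ⟨ha, rfl⟩⟩
  have hdS : density f g A S = m := by
    have h1 := htight.1
    have h2 := htight.2
    rw [Finset.sum_union hSA] at h1 h2
    rw [density, div_eq_iff (marginal_pos hfg hSsub hSne).ne', Finset.union_comm S A]
    rw [show g (A ∪ S) - g A = ∑ v ∈ S, y v by linarith, ← hxS]
    linarith
  -- Since A is tight, f(T|A) ≤ x(T) ≤ m y(T) ≤ m g(T|A): no marginal density exceeds m.
  have hbound : ∀ T, T ⊆ Aᶜ →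
      f (T ∪ A) - f A ≤ ∑ v ∈ T, x v ∧ ∑ v ∈ T, x v ≤ m * ∑ v ∈ T, y v ∧
        m * ∑ v ∈ T, y v ≤ m * (g (T ∪ A) - g A) := by
    intro T hT
    have hdis : Disjoint T A := Finset.disjoint_left.2 fun v hv => Finset.mem_compl.1 (hT hv)
    have h1 := hx.2.2 (T ∪ A)
    have h2 := hy.2.2 (T ∪ A)
    rw [Finset.sum_union hdis] at h1 h2
    refine ⟨by linarith, ?_, mul_le_mul_of_nonneg_left (by linarith) hm0⟩
    rw [Finset.mul_sum]
    exact Finset.sum_le_sum fun v hv =>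
      (div_le_iff₀ (hy0 v)).1 (hmax' v (Finset.mem_compl.1 (hT hv)))
  have hdense : IsDensest f g A S := by
    refine ⟨hSsub, hSne, fun T hT hTne => ?_⟩
    obtain ⟨h1, h2, h3⟩ := hbound T hT
    rw [hdS, density, div_le_iff₀ (marginal_pos hfg hT hTne)]
    linarith
  have hM := isDensest_maxDensest hfg hA
  have hMS : maxDensest f g A = S := by
    refine Finset.Subset.antisymm (fun v hv => ?_) (subset_maxDensest hdense)
    have hMd : density f g A (maxDensest f g A) = m := by
      rw [← hdS]
      exact le_antisymm (hdense.2.2 _ hM.1 hM.2.1) (hM.2.2 _ hSsub hSne)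
    rw [density, div_eq_iff (marginal_pos hfg hM.1 hM.2.1).ne'] at hMd
    obtain ⟨h1, h2, h3⟩ := hbound _ hM.1
    -- A set of density m has equality throughout the chain, so x = m y at each of its elements.
    have h4 : ∑ v ∈ maxDensest f g A, (m * y v - x v) = 0 := by
      rw [Finset.sum_sub_distrib, ← Finset.mul_sum]
      linarith
    have h5 := (Finset.sum_eq_zero_iff_of_nonneg fun v hv => sub_nonneg.2
      ((div_le_iff₀ (hy0 v)).1 (hmax' v (Finset.mem_compl.1 (hM.1 hv))))).1 h4 v hv
    refine (hSm v).2 ⟨Finset.mem_compl.1 (hM.1 hv), ?_⟩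
    rw [div_eq_iff (hy0 v).ne']
    linarith
  rw [hMS]
  refine ⟨fun u hu v hvA hvS => ?_, fun u hu => ?_, htight.1, htight.2⟩
  · rw [((hSm u).1 hu).2]
    exact lt_of_le_of_ne (hmax' v hvA) fun he => hvS ((hSm v).2 ⟨hvA, he⟩)
  · rw [hdS, ((hSm u).1 hu).2]

/-- The densities of a locally maximin allocation are those of the density decomposition. -/
theorem IsLocallyMaximin.div_eq_densityVector (hfg : IsInstance f g)
    (h : IsLocallyMaximin f g x y) (hx : x ∈ baseGE f) (hy : y ∈ baseLE g) (u : V) :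
    x u / y u = densityVector f g u := by
  have hstep : ∀ i, (∀ u ∈ firstParts f g i, ∀ v, v ∉ firstParts f g i →
      x v / y v < x u / y u) ∧ ∑ v ∈ firstParts f g i, x v = f (firstParts f g i) ∧
      ∑ v ∈ firstParts f g i, y v = g (firstParts f g i) := by
    intro i
    induction i with
    | zero => simp [firstParts, hfg.f_empty, hfg.g_empty]
    | succ i ih =>
      by_cases hU : firstParts f g i = Finset.univ
      · have hU' : firstParts f g (i + 1) = Finset.univ := by simp [firstParts, hU]
        rw [hU']
        exact ⟨fun u _ v hv => absurd (Finset.mem_univ v) hv, hx.2.1, hy.2.1⟩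
      · obtain ⟨h1, -, h3, h4⟩ := h.maxDensest_eq hfg hx hy hU ih.1 ih.2.1 ih.2.2
        refine ⟨fun u hu v hv => ?_, h3, h4⟩
        simp only [firstParts, Finset.mem_union, not_or] at hu hv
        rcases hu with hu | hu
        · exact ih.1 u hu v hv.1
        · exact h1 u hu v hv.1 hv.2
  classical
  have hmem : u ∈ part f g (partIndex f g u) := Nat.sInf_mem (existsUnique_mem_part hfg u).exists
  have hU : firstParts f g (partIndex f g u) ≠ Finset.univ := by
    intro hU
    have hsub : part f g (partIndex f g u) ⊆ (firstParts f g (partIndex f g u))ᶜ :=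
      Finset.sup_le fun S hS => (Finset.mem_filter.1 hS).2.1
    simpa [hU] using hsub hmem
  obtain ⟨h1, h2, h3⟩ := hstep (partIndex f g u)
  exact (h.maxDensest_eq hfg hx hy hU h1 h2 h3).2.1 u hmem

end Allocation

/-! ### Existence of a locally maximin allocation -/

theorem exists_arrangement_antitone {V : Type*} [Fintype V] (ρ : V → ℝ) :
    ∃ σ : Arrangement V, ∀ u v, ρ v < ρ u → σ u < σ v := by
  let e : Arrangement V := Fintype.equivFin V
  let k : Fin (Fintype.card V) → ℝ := fun i => -ρ (e.symm i)
  refine ⟨e.trans (Tuple.sort k).symm, fun u v huv => ?_⟩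
  by_contra hle
  have h1 := Tuple.monotone_sort k (not_lt.1 hle)
  simp [k] at h1
  linarith

section Existence

variable {V : Type*} [Fintype V] [DecidableEq V] {f g : Finset V → ℝ}

theorem meanMarginal_add_smul (h : Finset V → ℝ) (p q : Arrangement V → ℝ) (a b : ℝ) (u : V) :
    meanMarginal h (fun σ => a * p σ + b * q σ) u =
      a * meanMarginal h p u + b * meanMarginal h q u := by
  simp only [meanMarginal, Finset.mul_sum, ← Finset.sum_add_distrib]
  exact Finset.sum_congr rfl fun σ _ => by ring

/-- Each superlevel set of the density is an initial segment of every permutation of positive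
weight, so the marginals telescope over it. -/
theorem IsLocallyMaximinSolution.isLocallyMaximin (hfg : IsInstance f g) {p q : Arrangement V → ℝ}
    (h : IsLocallyMaximinSolution f g p q) :
    IsLocallyMaximin f g (meanMarginal f p) (meanMarginal g q) := by
  intro r _ S hS
  have hin : ∀ σ, (0 < p σ ∨ 0 < q σ) → ∀ u ∈ S, ∀ v, v ∉ S → σ u < σ v := by
    intro σ hσ u hu v hv
    refine h.2.2 u v ?_ σ hσ
    rw [hS] at hu hv
    exact (not_le.1 hv).trans_le hu
  exact ⟨sum_meanMarginal_of_initial hfg.f_empty h.1 fun σ hσ => hin σ (Or.inl hσ),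
    sum_meanMarginal_of_initial hfg.g_empty h.2.1 fun σ hσ => hin σ (Or.inr hσ)⟩

/-- A permutation distribution minimizing `∑ (f^p)² / g^p` exists. -/
theorem exists_min_sq_div (hfg : IsInstance f g) :
    ∃ p ∈ stdSimplex ℝ (Arrangement V), ∀ q ∈ stdSimplex ℝ (Arrangement V),
      ∑ u, meanMarginal f p u ^ 2 / meanMarginal g p u ≤
        ∑ u, meanMarginal f q u ^ 2 / meanMarginal g q u := by
  have hne : (stdSimplex ℝ (Arrangement V)).Nonempty :=
    ⟨_, single_mem_stdSimplex ℝ (Fintype.equivFin V)⟩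
  have hc : ∀ (h : Finset V → ℝ) (u : V), Continuous fun p => meanMarginal h p u := by
    intro h u
    simp only [meanMarginal]
    fun_prop
  obtain ⟨p, hp, hmin⟩ := (isCompact_stdSimplex (𝕜 := ℝ) (Arrangement V)).exists_isMinOn hne
    (f := fun p => ∑ u, meanMarginal f p u ^ 2 / meanMarginal g p u)
    (continuousOn_finsetSum _ fun u _ => ((hc f u).pow 2).continuousOn.div
      (hc g u).continuousOn fun p hp => (baseLE_pos hfg (meanMarginal_mem_baseLE hfg hp) u).ne')
  exact ⟨p, hp, fun q hq => hmin hq⟩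

/-- There is a permutation distribution whose mean marginal vectors form a locally maximin
allocation. -/
theorem exists_isLocallyMaximin (hfg : IsInstance f g) :
    ∃ p ∈ stdSimplex ℝ (Arrangement V),
      IsLocallyMaximin f g (meanMarginal f p) (meanMarginal g p) := by
  obtain ⟨p, hp, hmin⟩ := exists_min_sq_div hfg
  refine ⟨p, hp, ?_⟩
  have hx := meanMarginal_mem_baseGE hfg hp
  have hy := meanMarginal_mem_baseLE hfg hp
  have hy0 := baseLE_pos hfg hy
  set x := meanMarginal f p with hxdef
  set y := meanMarginal g p with hydef
  set ρ : V → ℝ := fun u => x u / y u with hρ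
  have hρ0 : ∀ u, 0 ≤ ρ u := div_nonneg_of_mem_base hx hy
  have hxρ : ∀ u, x u = ρ u * y u := fun u => (div_mul_cancel₀ _ (hy0 u).ne').symm
  obtain ⟨σ, hσ⟩ := exists_arrangement_antitone ρ
  set q : Arrangement V → ℝ := Pi.single σ 1 with hq
  have hqm : q ∈ stdSimplex ℝ (Arrangement V) := single_mem_stdSimplex ℝ σ
  have hx' := meanMarginal_mem_baseGE hfg hqm
  have hy' := meanMarginal_mem_baseLE hfg hqm
  have hini : ∀ r, ∀ τ, 0 < q τ → ∀ u ∈ Finset.univ.filter (fun v => r ≤ ρ v),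
      ∀ v, v ∉ Finset.univ.filter (fun v => r ≤ ρ v) → τ u < τ v := by
    intro r τ hτ u hu v hv
    have hτσ : τ = σ := by
      by_contra hne
      simp [hq, hne] at hτ
    simp only [Finset.mem_filter, Finset.mem_univ, true_and, not_le] at hu hv
    rw [hτσ]
    exact hσ u v (hv.trans_le hu)
  have hfq := fun r => sum_meanMarginal_of_initial hfg.f_empty hqm (hini r)
  have hgq := fun r => sum_meanMarginal_of_initial hfg.g_empty hqm (hini r)
  set x' := meanMarginal f q with hxdef'
  set y' := meanMarginal g q with hydef'
  obtain ⟨hA, hA'⟩ := sum_comp_mul_nonneg (ρ := ρ) (φ := fun r => r)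
    (d := fun u => x u - x' u) (fun _ _ h => h)
    (by rw [Finset.sum_sub_distrib, hx.2.1, hx'.2.1, sub_self]) (fun r => by
      rw [Finset.sum_sub_distrib, hfq]
      exact sub_nonneg.2 (hx.2.2 _))
  obtain ⟨hB, hB'⟩ := sum_comp_mul_nonneg (ρ := ρ) (φ := fun r => r ^ 2)
    (d := fun u => y' u - y u) (fun u v h => pow_le_pow_left₀ (hρ0 u) h 2)
    (by rw [Finset.sum_sub_distrib, hy.2.1, hy'.2.1, sub_self]) (fun r => by
      rw [Finset.sum_sub_distrib, hgq]
      exact sub_nonneg.2 (hy.2.2 _))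
  -- -L is the derivative of the objective from `p` towards `q`, since d(x²/y) = 2ρ dx - ρ² dy.
  set L := 2 * ∑ u, ρ u * (x u - x' u) + ∑ u, ρ u ^ 2 * (y' u - y u) with hL
  set C := ∑ u, 2 * (x' u - ρ u * y' u) ^ 2 / y u with hC
  have hC0 : 0 ≤ C := Finset.sum_nonneg fun u _ =>
    div_nonneg (mul_nonneg two_pos.le (sq_nonneg _)) (hy0 u).le
  -- moving from `p` towards `q` changes the objective by at most `-t L + t² C`
  have hLt : ∀ t : ℝ, 0 < t → t ≤ 1 / 2 → L ≤ t * C := by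
    intro t ht ht'
    have hmem : (fun τ => (1 - t) * p τ + t * q τ) ∈ stdSimplex ℝ (Arrangement V) := by
      refine ⟨fun τ => add_nonneg (mul_nonneg (by linarith) (hp.1 τ))
        (mul_nonneg ht.le (hqm.1 τ)), ?_⟩
      rw [Finset.sum_add_distrib, ← Finset.mul_sum, ← Finset.mul_sum, hp.2, hqm.2]
      ring
    have h1 := hmin _ hmem
    simp only [meanMarginal_add_smul, ← hxdef, ← hydef, ← hxdef', ← hydef'] at h1
    have h2 : ∑ u, ((1 - t) * x u + t * x' u) ^ 2 / ((1 - t) * y u + t * y' u) ≤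
        ∑ u, (x u ^ 2 / y u - t * (2 * (ρ u * (x u - x' u)) + ρ u ^ 2 * (y' u - y u)) +
          t ^ 2 * (2 * (x' u - ρ u * y' u) ^ 2 / y u)) := by
      refine Finset.sum_le_sum fun u _ => ?_
      have hpos := hy0 u
      -- This is where t ≤ 1/2 enters; it accounts for the factor 2 in C.
      have hY : y u / 2 ≤ (1 - t) * y u + t * y' u := by
        have := mul_nonneg ht.le (hy'.1 u)
        nlinarith
      have hY0 : 0 < (1 - t) * y u + t * y' u := by linarith
      have e1 : x u ^ 2 / y u = ρ u ^ 2 * y u := by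
        rw [hxρ u]; field_simp
      -- X²/Y = 2ρX - ρ²Y + (X - ρY)²/Y, where X - ρY = t(x' - ρy') because x = ρy.
      have e2 : ((1 - t) * x u + t * x' u) ^ 2 / ((1 - t) * y u + t * y' u) =
          2 * ρ u * ((1 - t) * x u + t * x' u) - ρ u ^ 2 * ((1 - t) * y u + t * y' u) +
            t ^ 2 * (x' u - ρ u * y' u) ^ 2 / ((1 - t) * y u + t * y' u) := by
        rw [div_eq_iff hY0.ne', add_mul, div_mul_cancel₀ _ hY0.ne', hxρ u]
        ring
      have e3 : t ^ 2 * (x' u - ρ u * y' u) ^ 2 / ((1 - t) * y u + t * y' u) ≤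
          t ^ 2 * (x' u - ρ u * y' u) ^ 2 / (y u / 2) :=
        div_le_div_of_nonneg_left (by positivity) (by linarith) hY
      have e4 : t ^ 2 * (x' u - ρ u * y' u) ^ 2 / (y u / 2) =
          t ^ 2 * (2 * (x' u - ρ u * y' u) ^ 2 / y u) := by
        field_simp
      have e5 := hxρ u
      rw [e1, e2, ← e4]
      have e6 : 2 * ρ u * ((1 - t) * x u + t * x' u) -
          ρ u ^ 2 * ((1 - t) * y u + t * y' u) = ρ u ^ 2 * y u -
            t * (2 * (ρ u * (x u - x' u)) + ρ u ^ 2 * (y' u - y u)) := by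
        rw [e5]; ring
      linarith
    rw [Finset.sum_add_distrib, Finset.sum_sub_distrib, ← Finset.mul_sum, ← Finset.mul_sum,
      Finset.sum_add_distrib, ← Finset.mul_sum] at h2
    have h3 : t * L ≤ t * (t * C) := by
      simp only [hL, hC]
      linarith
    exact le_of_mul_le_mul_left h3 ht
  have hL0 : L ≤ 0 := by
    by_contra hpos
    rw [not_le] at hpos
    -- This step size is at most 1/2 and gives t C ≤ L/2 < L.
    have h1 : 0 < L / (2 * (C + L)) := by positivity
    have h2 := hLt _ h1 (by
      rw [div_le_div_iff₀ (by positivity) two_pos]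
      linarith)
    rw [div_mul_eq_mul_div, le_div_iff₀ (by positivity)] at h2
    nlinarith
  refine IsLocallyMaximin.of_tight fun r => ?_
  -- L ≤ 0 is a positive combination of two non-negative Abel sums, so both vanish; their equality
  -- cases give tightness.
  have h1 := hA' (fun _ _ h => h) (by linarith) r
  have h2 := hB' (fun u v h => pow_lt_pow_left₀ h (hρ0 u) two_ne_zero) (by linarith) r
  rw [Finset.sum_sub_distrib, hfq] at h1
  rw [Finset.sum_sub_distrib, hgq] at h2
  exact ⟨sub_eq_zero.1 h1, (sub_eq_zero.1 h2).symm⟩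

end Existence

end DualModular

theorem theorem3 {V : Type*} [Fintype V] [DecidableEq V] (f g : Finset V → ℝ)
    (hfg : DualModular.IsInstance f g) (θ : ℝ → ℝ) (hθ : ConvexOn ℝ (Set.Ici 0) θ) :
    -- strictly convex `θ`: the minimizing allocations are the locally maximin ones
    (StrictConvexOn ℝ (Set.Ici 0) θ →
      ∀ x ∈ DualModular.baseGE f, ∀ y ∈ DualModular.baseLE g,
        (DualModular.IsMinimizer f g θ x y ↔ DualModular.IsLocallyMaximin f g x y)) ∧
    -- convex `θ`: locally maximin allocations are minimizers
    (∀ x ∈ DualModular.baseGE f, ∀ y ∈ DualModular.baseLE g,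
      DualModular.IsLocallyMaximin f g x y → DualModular.IsMinimizer f g θ x y) ∧
    -- convex `θ`: the optimum is attained by a pair `(p, p)`
    (∃ p : DualModular.Arrangement V → ℝ, DualModular.IsOptimalSolution f g θ p p ∧
      DualModular.IsMinimizer f g θ
        (DualModular.meanMarginal f p) (DualModular.meanMarginal g p)) ∧
    -- strictly convex `θ`: every optimal solution induces the density vector of the decomposition
    (StrictConvexOn ℝ (Set.Ici 0) θ →
      (∀ p q : DualModular.Arrangement V → ℝ, DualModular.IsOptimalSolution f g θ p q →
        ∀ u, DualModular.inducedDensity f g p q u = DualModular.densityVector f g u) ∧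
      (∀ x y : V → ℝ, DualModular.IsMinimizer f g θ x y →
        ∀ u, x u / y u = DualModular.densityVector f g u)) ∧
    -- convex `θ`: locally maximin solutions are optimal solutions
    (∀ p q : DualModular.Arrangement V → ℝ, DualModular.IsLocallyMaximinSolution f g p q →
      DualModular.IsOptimalSolution f g θ p q) := by
  obtain ⟨p₀, hp₀, hlm₀⟩ := DualModular.exists_isLocallyMaximin hfg
  have hx₀ := DualModular.meanMarginal_mem_baseGE hfg hp₀
  have hy₀ := DualModular.meanMarginal_mem_baseLE hfg hp₀
  have hsol : ∀ p ∈ stdSimplex ℝ (DualModular.Arrangement V),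
      ∀ q ∈ stdSimplex ℝ (DualModular.Arrangement V),
      DualModular.IsLocallyMaximin f g (DualModular.meanMarginal f p)
        (DualModular.meanMarginal g q) → DualModular.IsOptimalSolution f g θ p q :=
    fun p hp q hq h => ⟨hp, hq, fun p' hp' q' hq' =>
      (h.divergence_le hfg hθ (DualModular.meanMarginal_mem_baseGE hfg hp)
        (DualModular.meanMarginal_mem_baseLE hfg hq)
        (DualModular.meanMarginal_mem_baseGE hfg hp')
        (DualModular.meanMarginal_mem_baseLE hfg hq')).1⟩
  -- A minimizer does no worse than the reference allocation of `p₀`, so the equality case applies.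
  have hmin : StrictConvexOn ℝ (Set.Ici 0) θ → ∀ x y, DualModular.IsMinimizer f g θ x y →
      DualModular.IsLocallyMaximin f g x y := fun hst x y h =>
    ((hlm₀.divergence_le hfg hθ hx₀ hy₀ h.1 h.2.1).2 hst (h.2.2 _ hx₀ _ hy₀)).2
  refine ⟨fun hst x hx y hy => ⟨hmin hst x y, fun h => h.isMinimizer hfg hθ hx hy⟩,
    fun x hx y hy h => h.isMinimizer hfg hθ hx hy,
    ⟨p₀, hsol p₀ hp₀ p₀ hp₀ hlm₀, hlm₀.isMinimizer hfg hθ hx₀ hy₀⟩,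
    fun hst => ⟨fun p q h u => ?_, fun x y h u =>
      (hmin hst x y h).div_eq_densityVector hfg h.1 h.2.1 u⟩,
    fun p q h => hsol p h.1 q h.2.1 (h.isLocallyMaximin hfg)⟩
  -- The reference allocation is itself induced by a solution, so optimality among solutions
  -- suffices for the same comparison.
  have hx := DualModular.meanMarginal_mem_baseGE hfg h.1
  have hy := DualModular.meanMarginal_mem_baseLE hfg h.2.1
  exact ((hlm₀.divergence_le hfg hθ hx₀ hy₀ hx hy).2 hst
    (h.2.2 p₀ hp₀ p₀ hp₀)).2.div_eq_densityVector hfg hx hy u
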